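/- Let $y^2=x^3+f(z)x+g(z)$ with $f,g\in\mathbb C[z]$, $\deg f\le 8$, $\deg g\le 12$, be the Weierstrass form of an elliptically fibered K3 surface over $\mathbb P^1$ whose discriminant $\Delta=4f^3+27g^2$, as a section of degree $24$, has $24$ simple zeros on $\mathbb P^1$. Let $U\subset\mathbb C$ be an open set on which $\Delta\neq0$ and on which an $A$-cycle $\alpha$ and a $B$-cycle $\beta$ of the fibers, with $\alpha\cap\beta=1$, have been chosen (locally constantly in $z$). Let $M_U$ be the part of the fibration over $U$, with holomorphic coordinates $(z,\zeta)$, where $\zeta=\int\lambda$ (from the zero section) and $\lambda=dx/y$. Thus $M_U$ is the quotient of $U\times\mathbb C$ by the translations $\zeta\mapsto\zeta+m\int_\alpha\lambda+n\int_\beta\lambda$ ($m,n\in\mathbb Z$), the periods $\int_\alpha\lambda,\int_\beta\lambda$ being holomorphic in $z$. Put $$\tau=\tau_1+i\tau_2=\frac{\int_\beta\lambda}{\int_\alpha\lambda},\qquad (\mathcal M_{IJ})=\frac1{\tau_2}\begin{pmatrix}|\tau|^2&-\tau_1\\-\tau_1&1\end{pmatrix},\qquad (\kappa,\mu)=\int_\alpha\kappa\int_\beta\mu-\int_\beta\kappa\int_\alpha\mu,$$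 $W=-i\,(\bar\lambda,\lambda)=-i\int\bar\lambda\wedge\lambda>0$ (integral over the fiber), $\theta^z=dz$, and $$\theta^w=d\zeta-\frac{(\partial\lambda,\bar\lambda)\,\zeta-(\partial\lambda,\lambda)\,\bar\zeta}{(\lambda,\bar\lambda)}\,dz,$$ where the periods of $\partial\lambda$ are the $z$-derivatives of those of $\lambda$. For $t>0$ the semi-flat metric on $M_U$ is the Kähler metric with Kähler form $J_t=i\left(\frac Wt\,\theta^z\wedge\theta^{\bar z}+\frac tW\,\theta^w\wedge\theta^{\bar w}\right)$, and $*_{sf}$ is its Hodge star; $*$ is the Hodge star of the metric $W\,dz\,d\bar z$ on $U$. The orientations are normalized as follows: $U$ carries either the orientation of its complex structure or the opposite one, and $M_U$ carries the opposite of the orientation of its complex structure in the first case and the orientation of its complex structure in the second. **Proposition.** Let $\Xi$ be a smooth (complex-valued) two-form on $M_U$ that is harmonic for the semi-flat metric, i.e. $d\Xi=0$ and $d*_{sf}\Xi=0$, and whose components $\Xi_{z\bar z}$ and $\Xi_{w\bar w}$ in the coframe $\theta^z,\theta^{\bar z},\theta^w,\theta^{\bar w}$ vanish. Let $\xi=(\xi^1,\xi^2)=\left(\int_\alpha\Xi,\int_\beta\Xi\right)$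 be the doublet of one-forms on $U$ obtained by integration over the cycles of the fibers, with the convention $\int_\gamma(\omega\wedge dz)=\left(\int_\gamma\omega\right)dz$. Then $$*\mathcal M_{IJ}\,\xi^J=\begin{pmatrix}\int_\beta *_{sf}\Xi\\[2pt]-\int_\alpha *_{sf}\Xi\end{pmatrix}.$$ It follows that the one-forms $*\mathcal M_{IJ}\xi^J$ are smooth on $U$ and that $d*\mathcal M_{IJ}\xi^J=0$. -/

import Mathlib

open Complex Set
open scoped ContDiff ComplexConjugate

noncomputable section

namespace SemiflatK3

/-! ### Linear algebra: exterior products of covectors and the Hodge star -/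

section HodgeStar

variable {V : Type*} [NormedAddCommGroup V] [NormedSpace ℝ V]

/-- The (complexified) exterior product `φ 0 ∧ ⋯ ∧ φ (l - 1)` of real covectors,
`(v 0, …, v (l - 1)) ↦ det (φ i (v j))`. -/
def covectorWedge {l : ℕ} (φ : Fin l → V →L[ℝ] ℝ) : V [⋀^Fin l]→L[ℝ] ℂ :=
  Complex.ofRealCLM.compContinuousAlternatingMap
    { toMultilinearMap :=
        (Matrix.detRowAlternating.compLinearMap
          (LinearMap.pi fun i => (φ i : V →ₗ[ℝ] ℝ))).toMultilinearMap
      map_eq_zero_of_eq' :=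
        (Matrix.detRowAlternating.compLinearMap
          (LinearMap.pi fun i => (φ i : V →ₗ[ℝ] ℝ))).map_eq_zero_of_eq'
      cont := by
        change Continuous fun v : Fin l → V => Matrix.det (fun j i => φ i (v j))
        refine Continuous.matrix_det ?_
        fun_prop }

theorem covectorWedge_apply {l : ℕ} (φ : Fin l → V →L[ℝ] ℝ) (v : Fin l → V) :
    covectorWedge φ v = ((Matrix.of fun i j => φ i (v j)).det : ℂ) := by
  rw [← Matrix.det_transpose]
  rfl

/-- The Hodge star of a `k`-form on an oriented Euclidean space of dimension `k + l`.
`g u = g(u, ·)` is the metric, `e` is a `g`-orthonormal basis, and the orientation is the one of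
`e` if `o = 1`, the opposite one if `o = -1`. With the dual coframe `eⁱ = g(e i, ·)`,
`*η = o / (k! l!) ∑_σ sign σ · η(e_{σ 0}, …, e_{σ (k-1)}) e^{σ k} ∧ ⋯ ∧ e^{σ (k+l-1)}`,
extended complex linearly to complex-valued forms. -/
def hodgeStar {k l : ℕ} (o : ℤˣ) (g : V → V →L[ℝ] ℝ) (e : Fin (k + l) → V)
    (η : V [⋀^Fin k]→L[ℝ] ℂ) : V [⋀^Fin l]→L[ℝ] ℂ :=
  (((o : ℤ) : ℂ) / ((k.factorial : ℂ) * (l.factorial : ℂ))) •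
    ∑ σ : Equiv.Perm (Fin (k + l)),
      (((Equiv.Perm.sign σ : ℤ) : ℂ) * η fun i => e (σ (Fin.castAdd l i))) •
        covectorWedge fun j => g (e (σ (Fin.natAdd k j)))

end HodgeStar

/-! ### The elliptic fibration -/

/-- A smooth generic elliptically fibered K3 surface with section, in Weierstrass form
`y² = x³ + f(z) x + g(z)` over an affine coordinate `z` of the base `ℙ¹`: `f`, `g` are the
restrictions of sections of degree `8` and `12`, and the discriminant, as a section of degree `24`,
has `24` simple zeros on `ℙ¹` (one of which may be at infinity). -/
structure WeierstrassK3 where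
  f : Polynomial ℂ
  g : Polynomial ℂ
  natDegree_f_le : f.natDegree ≤ 8
  natDegree_g_le : g.natDegree ≤ 12
  squarefree_disc : Squarefree (4 * f ^ 3 + 27 * g ^ 2)
  le_natDegree_disc : 23 ≤ (4 * f ^ 3 + 27 * g ^ 2).natDegree

/-- The discriminant `Δ = 4 f³ + 27 g²`. -/
def WeierstrassK3.disc (X : WeierstrassK3) : Polynomial ℂ := 4 * X.f ^ 3 + 27 * X.g ^ 2

/-- The fibration over an open set `U` of the base that avoids the discriminant locus and on which
an `A`-cycle and a `B`-cycle have been chosen. `a` and `b` are the periods `∫_α λ`, `∫_β λ` of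
`λ = dx / y`; they are holomorphic, and form an oriented (`α ∩ β = 1`) `ℤ`-basis of the period
lattice of the fibre: with `ζ = ∫ λ`, the fibre over `z` is `ℂ / (ℤ a(z) + ℤ b(z))` by means of
`(x, y) = (4 ℘(ζ), 4 ℘'(ζ))`, for which `dx / y = dζ`.

The part of the fibration over `U` is thus the quotient of `U × ℂ`, with holomorphic coordinates
`(z, ζ)`, by the translations `(z, ζ) ↦ (z, ζ + m a(z) + n b(z))`, `m n : ℤ`. -/
structure FramedPatch (X : WeierstrassK3) where
  U : Set ℂ
  isOpen_U : IsOpen U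
  disc_ne_zero : ∀ z ∈ U, X.disc.eval z ≠ 0
  a : ℂ → ℂ
  b : ℂ → ℂ
  holomorphic_a : DifferentiableOn ℂ a U
  holomorphic_b : DifferentiableOn ℂ b U
  im_pos : ∀ z ∈ U, 0 < (b z / a z).im
  uniformization : ∀ z ∈ U, ∃ L : PeriodPair, L.ω₁ = a z ∧ L.ω₂ = b z ∧
    ∀ ζ : ℂ, ζ ∉ L.lattice →
      (4 * L.derivWeierstrassP ζ) ^ 2 =
        (4 * L.weierstrassP ζ) ^ 3 + X.f.eval z * (4 * L.weierstrassP ζ) + X.g.eval z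

namespace FramedPatch

variable {X : WeierstrassK3} (P : FramedPatch X)

/-- The domain `U × ℂ` of the coordinates `(z, ζ)`, the covering space of the fibration over `U`. -/
def cover : Set (ℂ × ℂ) := P.U ×ˢ univ

/-- The deck transformations `(z, ζ) ↦ (z, ζ + m a(z) + n b(z))`. -/
def deck (m n : ℤ) (p : ℂ × ℂ) : ℂ × ℂ := (p.1, p.2 + m * P.a p.1 + n * P.b p.1)

/-- The axio-dilaton `τ = ∫_β λ / ∫_α λ`. -/
def tau (z : ℂ) : ℂ := P.b z / P.a z

/-- The matrix `𝓜 = (1 / τ₂) (|τ|², -τ₁; -τ₁, 1)`. -/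
def axioMatrix (z : ℂ) : Matrix (Fin 2) (Fin 2) ℝ :=
  (1 / (P.tau z).im) • !![‖P.tau z‖ ^ 2, -(P.tau z).re; -(P.tau z).re, 1]

/-! ### The semi-flat metric -/

/-- The pairing `(κ, μ) = ∫_α κ ∫_β μ - ∫_β κ ∫_α μ` of closed one-forms on a fibre, in terms of
the periods `κ = (∫_α κ, ∫_β κ)` and `μ = (∫_α μ, ∫_β μ)`. -/
def periodPairing (κ μ : ℂ × ℂ) : ℂ := κ.1 * μ.2 - κ.2 * μ.1

/-- The periods of `λ`. -/
def lam (z : ℂ) : ℂ × ℂ := (P.a z, P.b z)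

/-- The periods of `λ̄`. -/
def lamBar (z : ℂ) : ℂ × ℂ := (conj (P.a z), conj (P.b z))

/-- The periods of `∂λ`, the derivative of `λ` with respect to `z`. -/
def dlam (z : ℂ) : ℂ × ℂ := (deriv P.a z, deriv P.b z)

/-- `W = -i ∫ λ̄ ∧ λ`, the integral being over the fibre. -/
def W (z : ℂ) : ℝ := (-I * periodPairing (P.lamBar z) (P.lam z)).re

/-- The coefficient `((∂λ, λ̄) ζ - (∂λ, λ) ζ̄) / (λ, λ̄)`. -/
def conn (p : ℂ × ℂ) : ℂ :=
  (periodPairing (P.dlam p.1) (P.lamBar p.1) * p.2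
      - periodPairing (P.dlam p.1) (P.lam p.1) * conj p.2)
    / periodPairing (P.lam p.1) (P.lamBar p.1)

/-- The one-form `θ^z = dz`. -/
def thetaZ : ℂ × ℂ →L[ℝ] ℂ := ContinuousLinearMap.fst ℝ ℂ ℂ

/-- The one-form `θ^w = dζ - ((∂λ, λ̄) ζ - (∂λ, λ) ζ̄) / (λ, λ̄) dz`. -/
def thetaW (p : ℂ × ℂ) : ℂ × ℂ →L[ℝ] ℂ :=
  ContinuousLinearMap.snd ℝ ℂ ℂ - P.conn p • ContinuousLinearMap.fst ℝ ℂ ℂ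

/-- The Kähler form `J_t = i ((W / t) θ^z ∧ θ^z̄ + (t / W) θ^w ∧ θ^w̄)` of the semi-flat metric. -/
def kahlerForm (t : ℝ) (p u v : ℂ × ℂ) : ℂ :=
  I * ((P.W p.1 / t : ℝ) * (thetaZ u * conj (thetaZ v) - thetaZ v * conj (thetaZ u))
    + (t / P.W p.1 : ℝ)
      * (P.thetaW p u * conj (P.thetaW p v) - P.thetaW p v * conj (P.thetaW p u)))

/-- The semi-flat metric `u ↦ g_t(u, ·)` on the tangent space at `p`,
`g_t(u, v) = 2 (W / t) Re (θ^z(u)‾ θ^z(v)) + 2 (t / W) Re (θ^w(u)‾ θ^w(v))`. -/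
def metric (t : ℝ) (p u : ℂ × ℂ) : ℂ × ℂ →L[ℝ] ℝ :=
  (2 * (P.W p.1 / t)) • (innerSL ℝ (thetaZ u)).comp thetaZ
    + (2 * (t / P.W p.1)) • (innerSL ℝ (P.thetaW p u)).comp (P.thetaW p)

theorem metric_apply (t : ℝ) (p u v : ℂ × ℂ) :
    P.metric t p u v = 2 * (P.W p.1 / t) * (conj (thetaZ u) * thetaZ v).re
      + 2 * (t / P.W p.1) * (conj (P.thetaW p u) * P.thetaW p v).re := by
  rw [mul_comm (conj (thetaZ u)), mul_comm (conj (P.thetaW p u))]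
  rfl

/-- The semi-flat metric is the Riemannian metric `J_t(·, i ·)` of `J_t`. -/
theorem metric_eq_kahlerForm (t : ℝ) (p u v : ℂ × ℂ) :
    (P.metric t p u v : ℂ) = P.kahlerForm t p u (I • v) := by
  have hz : thetaZ (I • v) = I * thetaZ v := rfl
  have hw : P.thetaW p (I • v) = I * P.thetaW p v := by
    simp [thetaW]
    ring
  rw [metric_apply, kahlerForm, hz, hw]
  apply Complex.ext <;> simp <;> ring

/-- The horizontal lift (kernel of `θ^w`) of a tangent vector of the base. -/
def hor (p : ℂ × ℂ) (v : ℂ) : ℂ × ℂ := (v, P.conn p * v)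

/-- The vertical tangent vector with `dζ`-component `v`. -/
def vert (v : ℂ) : ℂ × ℂ := (0, v)

/-- The orthonormal frame `(h, i h, v, i v)` of the semi-flat metric, with `h` horizontal and `v`
vertical. It induces the orientation of the complex structure. -/
def frame (t : ℝ) (p : ℂ × ℂ) : Fin (2 + 2) → ℂ × ℂ :=
  ![(√(2 * (P.W p.1 / t)))⁻¹ • P.hor p 1, (√(2 * (P.W p.1 / t)))⁻¹ • P.hor p I,
    (√(2 * (t / P.W p.1)))⁻¹ • vert 1, (√(2 * (t / P.W p.1)))⁻¹ • vert I]

theorem W_eq (z : ℂ) : P.W z = 2 * (conj (P.a z) * P.b z).im := by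
  simp [W, periodPairing, lam, lamBar]
  ring

theorem W_pos {z : ℂ} (hz : z ∈ P.U) : 0 < P.W z := by
  have h := P.im_pos z hz
  have ha : P.a z ≠ 0 := by
    intro h0
    simp [h0] at h
  have hn : 0 < Complex.normSq (P.a z) := Complex.normSq_pos.2 ha
  rw [Complex.div_im, ← sub_div] at h
  have h2 : 0 < (P.b z).im * (P.a z).re - (P.b z).re * (P.a z).im := by
    by_contra hc
    exact absurd h (not_lt.2 (div_nonpos_of_nonpos_of_nonneg (not_lt.1 hc) hn.le))
  rw [W_eq]
  simp
  nlinarith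

theorem frame_orthonormal {t : ℝ} (ht : 0 < t) {p : ℂ × ℂ} (hp : p ∈ P.cover)
    (i j : Fin (2 + 2)) :
    P.metric t p (P.frame t p i) (P.frame t p j) = if i = j then 1 else 0 := by
  have hW : 0 < P.W p.1 := P.W_pos hp.1
  have h1 : 0 < 2 * (P.W p.1 / t) := by positivity
  have h2 : 0 < 2 * (t / P.W p.1) := by positivity
  have key : ∀ c : ℝ, 0 < c → c * ((√c)⁻¹ * (√c)⁻¹) = 1 := by
    intro c hc
    rw [← mul_inv, Real.mul_self_sqrt hc.le, mul_inv_cancel₀ hc.ne']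
  have k1 := key _ h1
  have k2 := key _ h2
  have wh : ∀ (c : ℝ) (v : ℂ), P.thetaW p (c • P.hor p v) = 0 := by
    intro c v
    simp [thetaW, hor]
    ring
  have wv : ∀ (c : ℝ) (v : ℂ), P.thetaW p (c • vert v) = c * v := by
    intro c v
    simp [thetaW, vert]
  have zh : ∀ (c : ℝ) (v : ℂ), thetaZ (c • P.hor p v) = c * v := by
    intro c v
    simp [thetaZ, hor]
  have zv : ∀ (c : ℝ) (v : ℂ), thetaZ (c • vert v) = 0 := by
    intro c v
    simp [thetaZ, vert]
  rw [metric_apply, frame]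
  generalize 2 * (P.W p.1 / t) = A at *
  generalize 2 * (t / P.W p.1) = B at *
  fin_cases i <;> fin_cases j <;>
    simp only [Fin.zero_eta, Fin.mk_one, Fin.reduceFinMk, Matrix.cons_val, Matrix.cons_val_zero,
      Matrix.cons_val_one, wh, wv, zh, zv] <;>
    simp only [map_zero, map_mul, Complex.conj_ofReal, Complex.conj_I, map_one, Complex.mul_re,
      Complex.mul_im, Complex.ofReal_re, Complex.ofReal_im, Complex.I_re, Complex.I_im,
      Complex.one_re, Complex.one_im, Complex.neg_re, Complex.neg_im, Complex.zero_re,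
      Complex.zero_im] <;>
    simp only [Fin.reduceEq, if_true, if_false, zero_ne_one, one_ne_zero] <;>
    first
      | linear_combination k1
      | linear_combination k2
      | ring1

/-- The Hodge star `*_sf` of two-forms with respect to the semi-flat metric; `o = 1` is the
orientation of the complex structure, `o = -1` the opposite one. -/
def sfStar (t : ℝ) (o : ℤˣ) (Ξ : ℂ × ℂ → (ℂ × ℂ) [⋀^Fin 2]→L[ℝ] ℂ) (p : ℂ × ℂ) :
    (ℂ × ℂ) [⋀^Fin 2]→L[ℝ] ℂ :=
  hodgeStar (k := 2) (l := 2) o (P.metric t p) (P.frame t p) (Ξ p)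

/-! ### Two-forms -/

/-- The coefficient `Ξ_{z z̄}` of `θ^z ∧ θ^z̄` in the coframe `θ^z, θ^z̄, θ^w, θ^w̄`. -/
def compZZbar (Ξ : ℂ × ℂ → (ℂ × ℂ) [⋀^Fin 2]→L[ℝ] ℂ) (p : ℂ × ℂ) : ℂ :=
  (I / 2) * Ξ p ![P.hor p 1, P.hor p I]

/-- The coefficient `Ξ_{w w̄}` of `θ^w ∧ θ^w̄` in the coframe `θ^z, θ^z̄, θ^w, θ^w̄`. -/
def compWWbar (Ξ : ℂ × ℂ → (ℂ × ℂ) [⋀^Fin 2]→L[ℝ] ℂ) (p : ℂ × ℂ) : ℂ :=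
  (I / 2) * Ξ p ![vert 1, vert I]

/-- `Ξ` is a smooth two-form on the fibration over `U` (a smooth two-form on `U × ℂ` that is
invariant under the deck transformations) which is harmonic with respect to the semi-flat metric:
both `Ξ` and `*_sf Ξ` are closed. -/
structure IsSemiflatHarmonic (t : ℝ) (o : ℤˣ)
    (Ξ : ℂ × ℂ → (ℂ × ℂ) [⋀^Fin 2]→L[ℝ] ℂ) : Prop where
  smooth : ContDiffOn ℝ ∞ Ξ P.cover
  invariant : ∀ m n : ℤ, ∀ p ∈ P.cover,
    (Ξ (P.deck m n p)).compContinuousLinearMap (fderiv ℝ (P.deck m n) p) = Ξ p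
  closed : ∀ p ∈ P.cover, extDeriv Ξ p = 0
  coclosed : ∀ p ∈ P.cover, extDeriv (P.sfStar t o Ξ) p = 0

/-! ### Integration over the cycles of the fibres, and one-forms on the base -/

/-- `γ` is a smooth family of loops in the fibres over `U` that represents the cycle of period `c`:
`s ↦ γ z s`, `0 ≤ s ≤ 1`, is the `ζ`-coordinate along a loop in the fibre over `z`, and
`∫_γ λ = γ z 1 - γ z 0 = c z`. -/
structure IsCycle (c : ℂ → ℂ) (γ : ℂ → ℝ → ℂ) : Prop where
  smooth : ContDiffOn ℝ ∞ (fun q : ℂ × ℝ => γ q.1 q.2) (P.U ×ˢ univ)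
  period : ∀ z ∈ P.U, γ z 1 = γ z 0 + c z

end FramedPatch

/-- The one-form `∫_γ Ξ` on the base: the fibre integral of the pull-back of `Ξ` under
`(z, s) ↦ (z, γ z s)`, i.e. `(∫_γ Ξ)_z(v) = ∫₀¹ Ξ((0, ∂_s γ), (v, D_v γ)) ds`. The fibre direction
comes first, so that `∫_γ (ω ∧ dz) = (∫_γ ω) dz`. -/
def cycleIntegral (Ξ : ℂ × ℂ → (ℂ × ℂ) [⋀^Fin 2]→L[ℝ] ℂ) (γ : ℂ → ℝ → ℂ) (z : ℂ) :
    ℂ [⋀^Fin 1]→L[ℝ] ℂ :=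
  ∫ s in (0 : ℝ)..1,
    ((Ξ (z, γ z s)).curryLeft ((0 : ℂ), deriv (γ z) s)).compContinuousLinearMap
      (fderiv ℝ (fun z' : ℂ => (z', γ z' s)) z)

namespace FramedPatch

variable {X : WeierstrassK3} (P : FramedPatch X)

/-- The base metric `W dz dz̄`, as `u ↦ g(u, ·)`. -/
def baseMetric (z u : ℂ) : ℂ →L[ℝ] ℝ := P.W z • innerSL ℝ u

/-- The orthonormal frame `(h, i h)` of the base metric, inducing the complex orientation. -/
def baseFrame (z : ℂ) : Fin (1 + 1) → ℂ :=
  ![(√(P.W z))⁻¹ • (1 : ℂ), (√(P.W z))⁻¹ • I]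

theorem baseFrame_orthonormal {z : ℂ} (hz : z ∈ P.U) (i j : Fin (1 + 1)) :
    P.baseMetric z (P.baseFrame z i) (P.baseFrame z j) = if i = j then 1 else 0 := by
  have hW : 0 < P.W z := P.W_pos hz
  have k : P.W z * ((√(P.W z))⁻¹ * (√(P.W z))⁻¹) = 1 := by
    rw [← mul_inv, Real.mul_self_sqrt hW.le, mul_inv_cancel₀ hW.ne']
  fin_cases i <;> fin_cases j <;>
    simp [baseMetric, baseFrame, Complex.inner, -mul_eq_mul_left_iff,
      -mul_inv_rev, -mul_eq_mul_right_iff] <;>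
    linear_combination k

/-- The Hodge star `*` of one-forms on the base; `o = 1` is the complex orientation. -/
def baseStar (o : ℤˣ) (η : ℂ → ℂ [⋀^Fin 1]→L[ℝ] ℂ) (z : ℂ) : ℂ [⋀^Fin 1]→L[ℝ] ℂ :=
  hodgeStar (k := 1) (l := 1) o (P.baseMetric z) (P.baseFrame z) (η z)

/-- The doublet `𝓜_{IJ} ξ^J`. -/
def lower (ξ : Fin 2 → ℂ → ℂ [⋀^Fin 1]→L[ℝ] ℂ) (i : Fin 2) (z : ℂ) : ℂ [⋀^Fin 1]→L[ℝ] ℂ :=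
  ∑ j, P.axioMatrix z i j • ξ j z

end FramedPatch

/-- The doublet `ξ = (∫_α Ξ, ∫_β Ξ)`. -/
def doublet (α β : ℂ → ℝ → ℂ) (Ξ : ℂ × ℂ → (ℂ × ℂ) [⋀^Fin 2]→L[ℝ] ℂ) :
    Fin 2 → ℂ → ℂ [⋀^Fin 1]→L[ℝ] ℂ :=
  ![cycleIntegral Ξ α, cycleIntegral Ξ β]

end SemiflatK3

end

/-! Write `I` for the complex structure of the total space. In the orthonormal frame (h, ih, v, iv)
a two-form without z z̄ and w w̄ components has only mixed entries, and on these the Hodge star is,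
up to the orientation sign, the pull-back under `I` (`sfStar_eq_comp_mulI`), whatever `t` is. The
base star is likewise a signed precomposition with i (`baseStar_eq_comp_mulI`).

Contract Ξ with a base vector and restrict to a fibre. Since Ξ vanishes on vertical pairs, dΞ = 0
makes this one-form closed, and closedness of the pull-back of Ξ under `I` makes it coclosed. A
harmonic one-form on an elliptic curve is constant by Liouville
(`fibrewiseConstant_of_closed_coclosed`), so ∫_γ Ξ is the value of Ξ at the zero section with the
period of γ in its first slot (`cycleIntegral_eq`).

The matrix 𝓜 sends the periods (a, b) to (-ib, ia) (`axioMatrix_periods`). Both sides of the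
identity are therefore evaluations of Ξ on i times a period and i times a base vector, and the
opposite orientations make the signs agree.

Closedness uses the remaining hypothesis, that Ξ vanishes on horizontal pairs: real multiples of a
period are flat for the connection in θ^w, and differentiating the vanishing along them supplies the
missing term (`extDeriv_contractZeroSection`). -/

namespace SemiflatK3

/-! ### The Hodge star on an orthonormal frame. -/

section HodgeStar

variable {V : Type*} [NormedAddCommGroup V] [NormedSpace ℝ V]

theorem sum_perm_succ {M : Type*} [AddCommMonoid M] {n : ℕ} (F : Equiv.Perm (Fin (n + 1)) → M) :
    ∑ σ, F σ = ∑ p : Fin (n + 1), ∑ τ : Equiv.Perm (Fin n),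
      F (Equiv.Perm.decomposeFin.symm (p, τ)) := by
  rw [← Equiv.sum_comp Equiv.Perm.decomposeFin.symm F, Fintype.sum_prod_type]

/-- Splitting a permutation into the image of 0 and a permutation of the rest turns the sum into an
iterated one; each nontrivial transposition `swap 0 p` contributes a sign -1. -/
theorem sum_sign_perm_four (G : Fin 4 → Fin 4 → Fin 4 → Fin 4 → ℂ) :
    ∑ σ : Equiv.Perm (Fin 4), ((Equiv.Perm.sign σ : ℤ) : ℂ) * G (σ 0) (σ 1) (σ 2) (σ 3) =
      G 0 1 2 3 - G 0 1 3 2 - G 0 2 1 3 + G 0 2 3 1 + G 0 3 1 2 - G 0 3 2 1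
      - G 1 0 2 3 + G 1 0 3 2 + G 1 2 0 3 - G 1 2 3 0 - G 1 3 0 2 + G 1 3 2 0
      + G 2 0 1 3 - G 2 0 3 1 - G 2 1 0 3 + G 2 1 3 0 + G 2 3 0 1 - G 2 3 1 0
      - G 3 0 1 2 + G 3 0 2 1 + G 3 1 0 2 - G 3 1 2 0 - G 3 2 0 1 + G 3 2 1 0 := by
  have h2 : (2 : Fin 4) = Fin.succ 1 := rfl
  have h3 : (3 : Fin 4) = Fin.succ 2 := rfl
  have h2' : (2 : Fin 3) = Fin.succ 1 := rfl
  rw [sum_perm_succ]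
  have hs : ∀ (p : Fin 4) (τ : Equiv.Perm (Fin 3)),
      G (Equiv.Perm.decomposeFin.symm (p, τ) 0) (Equiv.Perm.decomposeFin.symm (p, τ) 1)
        (Equiv.Perm.decomposeFin.symm (p, τ) 2) (Equiv.Perm.decomposeFin.symm (p, τ) 3)
      = G p (Equiv.swap 0 p (τ 0).succ) (Equiv.swap 0 p (τ 1).succ)
        (Equiv.swap 0 p (τ 2).succ) := by
    intro p τ
    rw [h2, h3]
    simp only [Equiv.Perm.decomposeFin_symm_apply_succ, Equiv.Perm.decomposeFin_symm_apply_zero,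
      Equiv.Perm.decomposeFin_symm_apply_one]
  have ht : ∀ (H : Fin 3 → Fin 3 → Fin 3 → ℂ),
      ∑ τ : Equiv.Perm (Fin 3), ((Equiv.Perm.sign τ : ℤ) : ℂ) * H (τ 0) (τ 1) (τ 2) =
        H 0 1 2 - H 0 2 1 - H 1 0 2 + H 1 2 0 + H 2 0 1 - H 2 1 0 := by
    intro H
    have hh : ∀ (p : Fin 3) (τ : Equiv.Perm (Fin 2)),
        Equiv.Perm.decomposeFin.symm (p, τ) 2 = Equiv.swap 0 p (τ 1).succ := by
      intro p τ
      rw [h2', Equiv.Perm.decomposeFin_symm_apply_succ]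
    simp only [sum_perm_succ (n := 2), sum_perm_succ (n := 1), Fin.sum_univ_succ, hh]
    simp [Equiv.swap_apply_def]
    ring
  have hp : ∀ p : Fin 4, ∑ τ : Equiv.Perm (Fin 3),
      ((Equiv.Perm.sign (Equiv.Perm.decomposeFin.symm (p, τ)) : ℤ) : ℂ) *
        G p (Equiv.swap 0 p (τ 0).succ) (Equiv.swap 0 p (τ 1).succ) (Equiv.swap 0 p (τ 2).succ)
      = (if p = 0 then 1 else -1) * ∑ τ : Equiv.Perm (Fin 3), ((Equiv.Perm.sign τ : ℤ) : ℂ) *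
        G p (Equiv.swap 0 p (τ 0).succ) (Equiv.swap 0 p (τ 1).succ)
          (Equiv.swap 0 p (τ 2).succ) := by
    intro p
    rw [Finset.mul_sum]
    refine Finset.sum_congr rfl fun τ _ => ?_
    rw [Equiv.Perm.decomposeFin.symm_sign]
    split_ifs <;> simp
  simp only [hs, hp]
  simp only [fun p => ht fun a b c => G p (Equiv.swap 0 p a.succ)
    (Equiv.swap 0 p b.succ) (Equiv.swap 0 p c.succ)]
  simp [Fin.sum_univ_succ, Equiv.swap_apply_def]
  ring

theorem two_form_swap (η : V [⋀^Fin 2]→L[ℝ] ℂ) (u v : V) : η ![v, u] = -η ![u, v] := by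
  have h := η.toAlternatingMap.map_swap ![u, v] (i := 0) (j := 1) (by decide)
  have h2 : ![u, v] ∘ Equiv.swap (0 : Fin 2) 1 = ![v, u] := by
    funext i; fin_cases i <;> rfl
  rw [h2] at h
  exact h

theorem two_form_self (η : V [⋀^Fin 2]→L[ℝ] ℂ) (u : V) : η ![u, u] = 0 :=
  η.map_eq_zero_of_eq _ (by simp) (by decide : (0 : Fin 2) ≠ 1)

theorem hodgeStar_two_apply_frame (o : ℤˣ) {g : V → V →L[ℝ] ℝ} {e : Fin (2 + 2) → V}
    (he : ∀ i j, g (e i) (e j) = if i = j then 1 else 0) (η : V [⋀^Fin 2]→L[ℝ] ℂ) (i j : Fin 4) :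
    hodgeStar (k := 2) (l := 2) o g e η ![e i, e j] = ((o : ℤ) : ℂ) *
      !![0, η ![e 2, e 3], -η ![e 1, e 3], η ![e 1, e 2];
        -η ![e 2, e 3], 0, η ![e 0, e 3], -η ![e 0, e 2];
        η ![e 1, e 3], -η ![e 0, e 3], 0, η ![e 0, e 1];
        -η ![e 1, e 2], η ![e 0, e 2], -η ![e 0, e 1], 0] i j := by
  have h0 : ∀ σ : Equiv.Perm (Fin (2 + 2)), (fun j : Fin 2 => e (σ (Fin.castAdd 2 j))) =
      ![e (σ 0), e (σ 1)] := by
    intro i; funext j; fin_cases j <;> rfl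
  -- The 4 is 2!·2!. It cancels the four permutations that give the same term up to reordering
  -- within the two pairs.
  have h1 : hodgeStar (k := 2) (l := 2) o g e η ![e i, e j] = ((o : ℤ) : ℂ) / 4 *
      ∑ σ : Equiv.Perm (Fin 4), ((Equiv.Perm.sign σ : ℤ) : ℂ) *
        (η ![e (σ 0), e (σ 1)] * (((if σ 2 = i then 1 else 0) * (if σ 3 = j then 1 else 0)
          - (if σ 2 = j then 1 else 0) * (if σ 3 = i then 1 else 0) : ℝ) : ℂ)) := by
    rw [hodgeStar, ContinuousAlternatingMap.smul_apply, ContinuousAlternatingMap.sum_apply,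
      smul_eq_mul]
    congr 1
    · norm_num [Nat.factorial]
    · refine Finset.sum_congr rfl fun σ _ => ?_
      rw [ContinuousAlternatingMap.smul_apply, covectorWedge_apply, h0, Matrix.det_fin_two,
        smul_eq_mul, mul_assoc]
      simp only [Matrix.of_apply, he, Matrix.cons_val_zero, Matrix.cons_val_one]
      rfl
  rw [h1, sum_sign_perm_four fun a b c d => η ![e a, e b] *
    (((if c = i then 1 else 0) * (if d = j then 1 else 0)
          - (if c = j then 1 else 0) * (if d = i then 1 else 0) : ℝ) : ℂ)]
  have s10 := two_form_swap η (e 0) (e 1)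
  have s20 := two_form_swap η (e 0) (e 2)
  have s30 := two_form_swap η (e 0) (e 3)
  have s21 := two_form_swap η (e 1) (e 2)
  have s31 := two_form_swap η (e 1) (e 3)
  have s32 := two_form_swap η (e 2) (e 3)
  simp only [s10, s20, s30, s21, s31, s32]
  fin_cases i <;> fin_cases j <;> simp <;> ring

theorem hodgeStar_one_apply_frame (o : ℤˣ) {g : V → V →L[ℝ] ℝ} {e : Fin (1 + 1) → V}
    (he : ∀ i j, g (e i) (e j) = if i = j then 1 else 0) (η : V [⋀^Fin 1]→L[ℝ] ℂ) :
    hodgeStar (k := 1) (l := 1) o g e η (fun _ => e 0) = -(((o : ℤ) : ℂ) * η fun _ => e 1) ∧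
    hodgeStar (k := 1) (l := 1) o g e η (fun _ => e 1) = ((o : ℤ) : ℂ) * η fun _ => e 0 := by
  have h0 : ∀ i, (fun j : Fin 1 => e ((Equiv.swap 0 i) (Fin.castAdd 1 j))) =
      fun _ => e (Equiv.swap 0 i 0) := by
    intro i; funext j; fin_cases j; rfl
  constructor <;>
    simp [hodgeStar, covectorWedge_apply, he, sum_perm_succ, Fin.sum_univ_succ, h0]

end HodgeStar
-- Two-forms and multiplication by i.
theorem two_form_ext_basis {V ι : Type*} [NormedAddCommGroup V] [NormedSpace ℝ V]
    (e : Module.Basis ι ℝ V) {η θ : V [⋀^Fin 2]→L[ℝ] ℂ}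
    (h : ∀ i j, η ![e i, e j] = θ ![e i, e j]) : η = θ := by
  apply ContinuousAlternatingMap.toAlternatingMap_injective
  refine Module.Basis.ext_alternating e fun v _ => ?_
  have hv : (fun i => e (v i)) = ![e (v 0), e (v 1)] := by
    funext i; fin_cases i <;> rfl
  rw [hv]
  exact h _ _

theorem update_pair_zero {V : Type*} (u v x : V) : Function.update ![u, v] 0 x = ![x, v] := by
  funext i; fin_cases i <;> simp

theorem update_pair_one {V : Type*} (u v x : V) : Function.update ![u, v] 1 x = ![u, x] := by
  funext i; fin_cases i <;> simp

section Bilinear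

variable {V : Type*} [NormedAddCommGroup V] [NormedSpace ℝ V] (η : V [⋀^Fin 2]→L[ℝ] ℂ)

theorem two_form_smul (c d : ℝ) (u v : V) : η ![c • u, d • v] = c * d * η ![u, v] := by
  have h1 := η.map_update_smul ![u, d • v] 0 c u
  have h2 := η.map_update_smul ![u, v] 1 d v
  simp only [update_pair_zero, update_pair_one] at h1 h2
  rw [h1, h2]
  simp [mul_assoc]

theorem two_form_add_left (u u' v : V) : η ![u + u', v] = η ![u, v] + η ![u', v] := by
  have h := η.map_update_add ![u, v] 0 u u'
  simpa only [update_pair_zero] using h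

theorem two_form_add_right (u v v' : V) : η ![u, v + v'] = η ![u, v] + η ![u, v'] := by
  have h := η.map_update_add ![u, v] 1 v v'
  simpa only [update_pair_one] using h

theorem two_form_neg_right (u v : V) : η ![u, -v] = -η ![u, v] := by
  simpa using two_form_smul η 1 (-1) u v

theorem two_form_neg_left (u v : V) : η ![-u, v] = -η ![u, v] := by
  simpa using two_form_smul η (-1) 1 u v

end Bilinear

/-- Multiplication by `i` on `ℂ × ℂ` as a real linear map. -/
noncomputable def mulIProd : ℂ × ℂ →L[ℝ] ℂ × ℂ := I • ContinuousLinearMap.id ℝ (ℂ × ℂ)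

/-- Multiplication by `i` on `ℂ` as a real linear map. -/
noncomputable def mulI : ℂ →L[ℝ] ℂ := I • ContinuousLinearMap.id ℝ ℂ

theorem two_form_comp_mulIProd (η : (ℂ × ℂ) [⋀^Fin 2]→L[ℝ] ℂ) (u v : ℂ × ℂ) :
    η.compContinuousLinearMap mulIProd ![u, v] = η ![I • u, I • v] := by
  rw [ContinuousAlternatingMap.compContinuousLinearMap_apply]
  congr 1
  funext i; fin_cases i <;> simp [mulIProd]

namespace FramedPatch

variable {X : WeierstrassK3} (P : FramedPatch X)

theorem frame_linearIndependent {t : ℝ} (ht : 0 < t) {p : ℂ × ℂ} (hp : p ∈ P.cover) :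
    LinearIndependent ℝ (P.frame t p) := by
  rw [Fintype.linearIndependent_iff]
  intro c hc j
  have h := congrArg (P.metric t p (P.frame t p j)) hc
  simpa [P.frame_orthonormal ht hp] using h

theorem frame_one_eq (t : ℝ) (p : ℂ × ℂ) : P.frame t p 1 = I • P.frame t p 0 := by
  ext <;> simp [frame, hor] <;> ring

theorem frame_three_eq (t : ℝ) (p : ℂ × ℂ) : P.frame t p 3 = I • P.frame t p 2 := by
  ext <;> simp [frame, vert]
  ring

/-- On a two-form without `z z̄` and `w w̄` components, the Hodge star of the semi-flat metric is,
up to the sign of the orientation, the pull-back under the complex structure. -/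
theorem sfStar_eq_comp_mulI {t : ℝ} (ht : 0 < t) (o : ℤˣ)
    (Ξ : ℂ × ℂ → (ℂ × ℂ) [⋀^Fin 2]→L[ℝ] ℂ) {p : ℂ × ℂ} (hp : p ∈ P.cover)
    (hzz : P.compZZbar Ξ p = 0) (hww : compWWbar Ξ p = 0) :
    P.sfStar t o Ξ p = -((o : ℤ) : ℝ) • (Ξ p).compContinuousLinearMap mulIProd := by
  have hI : I / 2 ≠ 0 := by simp
  have h01 : Ξ p ![P.frame t p 0, I • P.frame t p 0] = 0 := by
    rw [← frame_one_eq]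
    change Ξ p ![_ • P.hor p 1, _ • P.hor p I] = 0
    rw [two_form_smul, (mul_eq_zero.1 hzz).resolve_left hI, mul_zero]
  have h23 : Ξ p ![P.frame t p 2, I • P.frame t p 2] = 0 := by
    rw [← frame_three_eq]
    change Ξ p ![_ • vert 1, _ • vert I] = 0
    rw [two_form_smul, (mul_eq_zero.1 hww).resolve_left hI, mul_zero]
  let B := basisOfLinearIndependentOfCardEqFinrank (P.frame_linearIndependent ht hp)
    (by simp)
  have hB : ∀ i, B i = P.frame t p i := fun i => by simp [B]
  -- On mixed pairs the star and the pull-back agree entry by entry. On the planes (0, 1) and (2, 3)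
  -- they differ, since the star exchanges the planes and the pull-back preserves each; there both
  -- sides vanish by `h01` and `h23`.
  refine two_form_ext_basis B fun i j => ?_
  rw [hB, hB, sfStar, hodgeStar_two_apply_frame o (P.frame_orthonormal ht hp),
    ContinuousAlternatingMap.smul_apply, two_form_comp_mulIProd, frame_one_eq, frame_three_eq]
  have hII : ∀ v : ℂ × ℂ, I • I • v = -v := by
    intro v; rw [smul_smul, I_mul_I, neg_one_smul]
  have s := two_form_swap (Ξ p)
  fin_cases i <;> fin_cases j <;>
    simp [frame_one_eq, frame_three_eq, hII, two_form_self, h01, h23, two_form_neg_left,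
      two_form_neg_right, s (P.frame t p 0) (P.frame t p 2),
      s (P.frame t p 0) (I • P.frame t p 0), s (P.frame t p 0) (I • P.frame t p 2),
      s (P.frame t p 2) (I • P.frame t p 2), s (I • P.frame t p 0) (P.frame t p 2),
      s (I • P.frame t p 0) (I • P.frame t p 2)]

theorem baseStar_eq_comp_mulI (o : ℤˣ) (η : ℂ → ℂ [⋀^Fin 1]→L[ℝ] ℂ) {z : ℂ} (hz : z ∈ P.U) :
    P.baseStar o η z = -((o : ℤ) : ℝ) • (η z).compContinuousLinearMap mulI := by
  have hli : LinearIndependent ℝ (P.baseFrame z) := by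
    rw [Fintype.linearIndependent_iff]
    intro c hc j
    have h := congrArg (P.baseMetric z (P.baseFrame z j)) hc
    rw [map_sum, map_zero] at h
    simpa only [map_smul, P.baseFrame_orthonormal hz, smul_eq_mul, mul_ite, mul_one, mul_zero,
      Finset.sum_ite_eq, Finset.mem_univ, if_true] using h
  let B := basisOfLinearIndependentOfCardEqFinrank hli (by simp)
  have hB : ∀ i, B i = P.baseFrame z i := fun i => by simp [B]
  have h1 : P.baseFrame z 1 = I • P.baseFrame z 0 := by
    simp [baseFrame]; ring
  have h2 : I • P.baseFrame z 1 = -P.baseFrame z 0 := by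
    rw [h1, smul_smul, I_mul_I, neg_one_smul]
  have hneg : η z (fun _ => -P.baseFrame z 0) = -η z fun _ => P.baseFrame z 0 := by
    have := (η z).map_update_neg (fun _ => P.baseFrame z 0) 0 (P.baseFrame z 0)
    have e : ∀ x : ℂ, Function.update (fun _ : Fin 1 => P.baseFrame z 0) 0 x = fun _ => x := by
      intro x; funext i; fin_cases i; simp
    rwa [e, e] at this
  obtain ⟨a0, a1⟩ := hodgeStar_one_apply_frame o (P.baseFrame_orthonormal hz) (η z)
  apply ContinuousAlternatingMap.toAlternatingMap_injective
  refine Module.Basis.ext_alternating B fun v _ => ?_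
  have hv : (fun i => B (v i)) = fun _ => P.baseFrame z (v 0) := by
    funext i; fin_cases i; exact hB _
  rw [hv]
  change hodgeStar (k := 1) (l := 1) o (P.baseMetric z) (P.baseFrame z) (η z) _
    = -((o : ℤ) : ℝ) • η z (fun _ => I • P.baseFrame z (v 0))
  generalize v 0 = j
  fin_cases j
  · refine a0.trans ?_
    simp [h1]
  · refine a1.trans ?_
    change _ = -((o : ℤ) : ℝ) • η z (fun _ => I • P.baseFrame z 1)
    rw [h2, hneg]
    simp

end FramedPatch
-- Harmonic one-forms on an elliptic curve, and exterior derivatives in coordinates.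
theorem entire_periodic_eq (L : PeriodPair) {f : ℂ → ℂ} (hf : Differentiable ℂ f)
    (hp : ∀ ζ, ∀ w ∈ L.lattice, f (ζ + w) = f ζ) (ζ : ℂ) : f ζ = f 0 :=
  hf.apply_eq_apply_of_bounded
    (IsZLattice.isCompact_range_of_periodic L.lattice f hf.continuous hp).isBounded ζ 0

/-- Closedness and coclosedness together are the Cauchy-Riemann equations for f - ig, so Liouville
applies. -/
theorem periodic_sub_I_mul_eq (L : PeriodPair) {f g : ℂ → ℂ} (hf : Differentiable ℝ f)
    (hg : Differentiable ℝ g) (h1 : ∀ ζ, fderiv ℝ f ζ I = fderiv ℝ g ζ 1)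
    (h2 : ∀ ζ, fderiv ℝ f ζ 1 = -fderiv ℝ g ζ I)
    (pf : ∀ ζ, ∀ w ∈ L.lattice, f (ζ + w) = f ζ) (pg : ∀ ζ, ∀ w ∈ L.lattice, g (ζ + w) = g ζ)
    (ζ : ℂ) : f ζ - I * g ζ = f 0 - I * g 0 := by
  refine entire_periodic_eq L (f := fun ζ => f ζ - I * g ζ) (fun x => ?_) (fun ζ w hw => ?_) ζ
  · have hd := (hf x).hasFDerivAt.fun_sub ((hg x).hasFDerivAt.const_mul I)
    rw [differentiableAt_complex_iff_differentiableAt_real]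
    refine ⟨hd.differentiableAt, ?_⟩
    rw [hd.fderiv]
    simp [h1, h2]
    linear_combination (fderiv ℝ g x 1) * I_sq
  · simp only [pf ζ w hw, pg ζ w hw]

/-- A closed and coclosed one-form `f dx + g dy` on an elliptic curve is constant. -/
theorem closed_coclosed_periodic_eq (L : PeriodPair) {f g : ℂ → ℂ} (hf : Differentiable ℝ f)
    (hg : Differentiable ℝ g) (h1 : ∀ ζ, fderiv ℝ f ζ I = fderiv ℝ g ζ 1)
    (h2 : ∀ ζ, fderiv ℝ f ζ 1 = -fderiv ℝ g ζ I)
    (pf : ∀ ζ, ∀ w ∈ L.lattice, f (ζ + w) = f ζ) (pg : ∀ ζ, ∀ w ∈ L.lattice, g (ζ + w) = g ζ)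
    (ζ : ℂ) : f ζ = f 0 ∧ g ζ = g 0 := by
  have k1 := periodic_sub_I_mul_eq L hf hg h1 h2 pf pg ζ
  have conj_fderiv : ∀ {k : ℂ → ℂ}, Differentiable ℝ k → ∀ ζ v,
      fderiv ℝ (fun ζ => conj (k ζ)) ζ v = conj (fderiv ℝ k ζ v) := by
    intro k hk ζ v
    have := (conjCLE.toContinuousLinearMap.hasFDerivAt (x := k ζ)).comp ζ (hk ζ).hasFDerivAt
    have h := this.fderiv
    change fderiv ℝ (fun ζ => conj (k ζ)) ζ = _ at h
    rw [h]
    rfl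
  have conj_diff : ∀ {k : ℂ → ℂ}, Differentiable ℝ k → Differentiable ℝ fun ζ => conj (k ζ) :=
    fun hk => conjCLE.toContinuousLinearMap.differentiable.comp hk
  -- As f and g are complex-valued, f - ig alone does not determine them. The hypotheses are stable
  -- under conjugation, and conjugating the result for f̄, ḡ gives the constancy of f + ig.
  have k2 := periodic_sub_I_mul_eq L (conj_diff hf) (conj_diff hg)
    (fun ζ => by rw [conj_fderiv hf, conj_fderiv hg, h1])
    (fun ζ => by rw [conj_fderiv hf, conj_fderiv hg, h2, map_neg])
    (fun ζ w hw => by rw [pf ζ w hw]) (fun ζ w hw => by rw [pg ζ w hw]) ζ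
  have k3 := congrArg (starRingEnd ℂ) k2
  simp only [map_sub, map_mul, conj_conj, conj_I] at k3
  constructor
  · linear_combination (k1 + k3) / 2
  · linear_combination (I * k1 - I * k3) / 2 + (g ζ - g 0) * I_sq

theorem extDeriv_two_form_apply {V : Type*} [NormedAddCommGroup V] [NormedSpace ℝ V]
    {Ψ : V → V [⋀^Fin 2]→L[ℝ] ℂ} {p : V} (h : DifferentiableAt ℝ Ψ p) (x y w : V) :
    extDeriv Ψ p ![x, y, w] = fderiv ℝ Ψ p x ![y, w] - fderiv ℝ Ψ p y ![x, w]
      + fderiv ℝ Ψ p w ![x, y] := by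
  have r0 : Fin.removeNth 0 ![x, y, w] = ![y, w] := by funext i; fin_cases i <;> rfl
  have r1 : Fin.removeNth 1 ![x, y, w] = ![x, w] := by funext i; fin_cases i <;> rfl
  have r2 : Fin.removeNth 2 ![x, y, w] = ![x, y] := by funext i; fin_cases i <;> rfl
  rw [extDeriv_apply h]
  simp [fderiv_continuousAlternatingMap_apply_const_apply h, Fin.sum_univ_three, r0, r1, r2]
  ring

theorem extDeriv_one_form_apply {V : Type*} [NormedAddCommGroup V] [NormedSpace ℝ V]
    {Ψ : V → V [⋀^Fin 1]→L[ℝ] ℂ} {p : V} (h : DifferentiableAt ℝ Ψ p) (x y : V) :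
    extDeriv Ψ p ![x, y] = fderiv ℝ (fun q => Ψ q fun _ => y) p x
      - fderiv ℝ (fun q => Ψ q fun _ => x) p y := by
  have r0 : Fin.removeNth 0 ![x, y] = fun _ => y := by funext i; fin_cases i; rfl
  have r1 : Fin.removeNth 1 ![x, y] = fun _ => x := by funext i; fin_cases i; rfl
  rw [extDeriv_apply h]
  simp [Fin.sum_univ_two, r0, r1]
  ring

theorem two_form_eq_zero_of_span {V : Type*} [NormedAddCommGroup V] [NormedSpace ℝ V]
    (η : V [⋀^Fin 2]→L[ℝ] ℂ) {u v : V} (h : η ![u, v] = 0) (a b c d : ℝ) :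
    η ![a • u + b • v, c • u + d • v] = 0 := by
  simp [two_form_add_left, two_form_add_right, two_form_smul, two_form_self,
    two_form_swap η u v, h]

/-- The contraction of a two-form with vertical vectors along the zero section, as a linear map
from vertical vectors to covectors of the base. -/
noncomputable def contractZeroSection (Ψ : ℂ × ℂ → (ℂ × ℂ) [⋀^Fin 2]→L[ℝ] ℂ) (z : ℂ) :
    ℂ →L[ℝ] ℂ [⋀^Fin 1]→L[ℝ] ℂ :=
  (ContinuousAlternatingMap.compContinuousLinearMapCLM (ContinuousLinearMap.inl ℝ ℂ ℂ)).comp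
    ((Ψ (z, 0)).curryLeft.comp (ContinuousLinearMap.inr ℝ ℂ ℂ))

theorem contractZeroSection_apply (Ψ : ℂ × ℂ → (ℂ × ℂ) [⋀^Fin 2]→L[ℝ] ℂ) (z u v : ℂ) :
    contractZeroSection Ψ z u (fun _ => v) = Ψ (z, 0) ![(0, u), (v, 0)] := by
  change Ψ (z, 0) _ = _
  congr 1
  funext i; fin_cases i <;> rfl

theorem one_form_ext {V : Type*} [NormedAddCommGroup V] [NormedSpace ℝ V]
    {η θ : V [⋀^Fin 1]→L[ℝ] ℂ} (h : ∀ v, η (fun _ => v) = θ fun _ => v) : η = θ := by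
  ext v
  have hv : v = fun _ => v 0 := by funext i; fin_cases i; rfl
  rw [hv]
  exact h _

theorem contDiff_curryLeft {V : Type*} [NormedAddCommGroup V] [NormedSpace ℝ V] {n : ℕ} :
    ContDiff ℝ ∞ fun η : V [⋀^Fin (n + 1)]→L[ℝ] ℂ => η.curryLeft :=
  IsBoundedLinearMap.contDiff <| IsLinearMap.with_bound
    ⟨ContinuousAlternatingMap.curryLeft_add, ContinuousAlternatingMap.curryLeft_smul⟩ 1
    fun η => (by rw [one_mul]; exact (ContinuousAlternatingMap.norm_curryLeft η).le)

/-! ### Constancy along the fibres and integrals over cycles. -/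

namespace FramedPatch

variable {X : WeierstrassK3} (P : FramedPatch X)

theorem isOpen_cover : IsOpen P.cover := P.isOpen_U.prod isOpen_univ

/-- A two-form vanishes on pairs of vertical vectors. -/
def VanishesOnVertical (Ψ : ℂ × ℂ → (ℂ × ℂ) [⋀^Fin 2]→L[ℝ] ℂ) : Prop :=
  ∀ p ∈ P.cover, ∀ u u' : ℂ, Ψ p ![(0, u), (0, u')] = 0

/-- The mixed components of a two-form do not depend on the point of the fibre. -/
def FibrewiseConstant (Ψ : ℂ × ℂ → (ℂ × ℂ) [⋀^Fin 2]→L[ℝ] ℂ) : Prop :=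
  ∀ z ∈ P.U, ∀ ζ u v : ℂ, Ψ (z, ζ) ![(0, u), (v, 0)] = Ψ (z, 0) ![(0, u), (v, 0)]

variable {P} {Ψ : ℂ × ℂ → (ℂ × ℂ) [⋀^Fin 2]→L[ℝ] ℂ}

theorem vanishesOnVertical_of_compWWbar (h : ∀ p ∈ P.cover, compWWbar Ψ p = 0) :
    P.VanishesOnVertical Ψ := by
  intro p hp u u'
  have h1 : Ψ p ![vert 1, vert I] = 0 := (mul_eq_zero.1 (h p hp)).resolve_left (by simp)
  have e : ∀ u : ℂ, ((0, u) : ℂ × ℂ) = u.re • vert 1 + u.im • vert I := by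
    intro u
    simp [vert, re_add_im]
  rw [e u, e u']
  exact two_form_eq_zero_of_span _ h1 _ _ _ _

theorem hor_pair_eq_zero {p : ℂ × ℂ} (h : P.compZZbar Ψ p = 0) (v v' : ℂ) :
    Ψ p ![P.hor p v, P.hor p v'] = 0 := by
  have h1 : Ψ p ![P.hor p 1, P.hor p I] = 0 := (mul_eq_zero.1 h).resolve_left (by simp)
  have e : ∀ v : ℂ, P.hor p v = v.re • P.hor p 1 + v.im • P.hor p I := by
    intro v
    have hv := re_add_im v
    ext
    · simp [hor, hv]
    · simp [hor]
      linear_combination -P.conn p * hv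
  rw [e v, e v']
  exact two_form_eq_zero_of_span _ h1 _ _ _ _

theorem VanishesOnVertical.apply_vert_left (h : P.VanishesOnVertical Ψ) {p : ℂ × ℂ}
    (hp : p ∈ P.cover) (u v w : ℂ) : Ψ p ![(0, u), (v, w)] = Ψ p ![(0, u), (v, 0)] := by
  have e : ((v, w) : ℂ × ℂ) = (v, 0) + (0, w) := by simp
  rw [e, two_form_add_right, h p hp, add_zero]

theorem hasFDerivAt_fibre {z ζ : ℂ} (h : DifferentiableAt ℝ Ψ (z, ζ)) (x y : ℂ × ℂ) :
    HasFDerivAt (fun ζ => Ψ (z, ζ) ![x, y])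
      (((fderiv ℝ Ψ (z, ζ)).flipAlternating ![x, y]).comp (ContinuousLinearMap.inr ℝ ℂ ℂ)) ζ :=
  (h.hasFDerivAt.continuousAlternatingMap_apply_const ![x, y]).comp ζ
    (hasFDerivAt_prodMk_right z ζ)

/-- The restriction to the fibres of the contraction of a closed form with a base vector is
closed. -/
theorem VanishesOnVertical.fibre_closed (h : P.VanishesOnVertical Ψ)
    (hd : ∀ p ∈ P.cover, DifferentiableAt ℝ Ψ p) (hc : ∀ p ∈ P.cover, extDeriv Ψ p = 0)
    {z : ℂ} (hz : z ∈ P.U) (ζ u u' v : ℂ) :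
    fderiv ℝ (fun ζ => Ψ (z, ζ) ![(0, u), (v, 0)]) ζ u' =
      fderiv ℝ (fun ζ => Ψ (z, ζ) ![(0, u'), (v, 0)]) ζ u := by
  have hp : ((z, ζ) : ℂ × ℂ) ∈ P.cover := ⟨hz, mem_univ _⟩
  have h1 := extDeriv_two_form_apply (hd _ hp) (0, u) (0, u') (v, 0)
  rw [hc _ hp] at h1
  -- The term of dΨ that differentiates in the base direction involves only the vertical pair, on
  -- which Ψ is identically zero near the point.
  have h2 : fderiv ℝ Ψ (z, ζ) (v, 0) ![(0, u), (0, u')] = 0 := by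
    rw [← fderiv_continuousAlternatingMap_apply_const_apply (hd _ hp)]
    have : (fun q => Ψ q ![(0, u), (0, u')]) =ᶠ[nhds (z, ζ)] fun _ => 0 :=
      Filter.eventually_of_mem (P.isOpen_cover.mem_nhds hp) fun q hq => h q hq u u'
    rw [this.fderiv_eq]
    simp
  rw [(hasFDerivAt_fibre (hd _ hp) _ _).fderiv, (hasFDerivAt_fibre (hd _ hp) _ _).fderiv]
  simp at h1 ⊢
  linear_combination h1 + h2

/-- The differential of a deck transformation fixes vertical vectors and adds to (v, 0) a vertical
part coming from the derivatives of the periods; that part is killed against a vertical vector. This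
gives the periodicity needed for Liouville. -/
theorem deck_apply_mixed (h : P.VanishesOnVertical Ψ)
    (hinv : ∀ m n : ℤ, ∀ p ∈ P.cover,
      (Ψ (P.deck m n p)).compContinuousLinearMap (fderiv ℝ (P.deck m n) p) = Ψ p)
    {z : ℂ} (hz : z ∈ P.U) (m n : ℤ) (ζ u v : ℂ) :
    Ψ (z, ζ + (m * P.a z + n * P.b z)) ![(0, u), (v, 0)] = Ψ (z, ζ) ![(0, u), (v, 0)] := by
  have hp : ((z, ζ) : ℂ × ℂ) ∈ P.cover := ⟨hz, mem_univ _⟩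
  have hU := P.isOpen_U.mem_nhds hz
  obtain ⟨A, hA⟩ := ((P.holomorphic_a.differentiableAt hU).restrictScalars ℝ)
  obtain ⟨B, hB⟩ := ((P.holomorphic_b.differentiableAt hU).restrictScalars ℝ)
  have hfst : HasFDerivAt (fun p : ℂ × ℂ => p.1) (ContinuousLinearMap.fst ℝ ℂ ℂ) (z, ζ) :=
    hasFDerivAt_fst
  have hdeck : HasFDerivAt (P.deck m n) _ (z, ζ) :=
    hfst.prodMk ((hasFDerivAt_snd.add ((hA.comp (z, ζ) hfst).const_mul (m : ℂ))).add
      ((hB.comp (z, ζ) hfst).const_mul (n : ℂ)))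
  have h1 := congrArg (fun η => η ![(0, u), (v, 0)]) (hinv m n _ hp)
  rw [hdeck.fderiv] at h1
  rw [← h1, ContinuousAlternatingMap.compContinuousLinearMap_apply]
  have e : ∀ L : ℂ × ℂ →L[ℝ] ℂ × ℂ, L ∘ ![(0, u), (v, 0)] = ![L (0, u), L (v, 0)] := by
    intro L; funext i; fin_cases i <;> rfl
  rw [e]
  simp [deck]
  rw [← add_assoc]
  exact (h.apply_vert_left (p := (z, _)) ⟨hz, mem_univ _⟩ _ _ _).symm

theorem fibrewiseConstant_of_closed_coclosed (h : P.VanishesOnVertical Ψ)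
    (hd : ∀ p ∈ P.cover, DifferentiableAt ℝ Ψ p) (hc : ∀ p ∈ P.cover, extDeriv Ψ p = 0)
    (hc' : ∀ p ∈ P.cover, extDeriv (fun p => (Ψ p).compContinuousLinearMap mulIProd) p = 0)
    (hinv : ∀ m n : ℤ, ∀ p ∈ P.cover,
      (Ψ (P.deck m n p)).compContinuousLinearMap (fderiv ℝ (P.deck m n) p) = Ψ p) :
    P.FibrewiseConstant Ψ := by
  intro z hz ζ u v
  have hp : ∀ ζ, ((z, ζ) : ℂ × ℂ) ∈ P.cover := fun _ => ⟨hz, mem_univ _⟩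
  obtain ⟨L, hLa, hLb, -⟩ := P.uniformization z hz
  have hper : ∀ u ζ : ℂ, ∀ w ∈ L.lattice,
      Ψ (z, ζ + w) ![(0, u), (v, 0)] = Ψ (z, ζ) ![(0, u), (v, 0)] := by
    intro u ζ w hw
    obtain ⟨m, n, rfl⟩ := PeriodPair.mem_lattice.1 hw
    rw [hLa, hLb]
    exact deck_apply_mixed h hinv hz m n ζ u v
  have hdiff : ∀ u : ℂ, Differentiable ℝ fun ζ => Ψ (z, ζ) ![(0, u), (v, 0)] :=
    fun u ζ => (hasFDerivAt_fibre (hd _ (hp ζ)) _ _).differentiableAt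
  have hI : P.VanishesOnVertical fun p => (Ψ p).compContinuousLinearMap mulIProd := by
    intro p hp u u'
    rw [two_form_comp_mulIProd]
    simpa using h p hp (I * u) (I * u')
  have hdI : ∀ p ∈ P.cover,
      DifferentiableAt ℝ (fun p => (Ψ p).compContinuousLinearMap mulIProd) p := fun p hp =>
    (ContinuousAlternatingMap.compContinuousLinearMapCLM (F := ℂ) (ι := Fin 2)
      mulIProd).hasFDerivAt.comp p (hd p hp).hasFDerivAt |>.differentiableAt
  have hneg : ∀ (ζ : ℂ), Ψ (z, ζ) ![(0, -1), (v, 0)] = -Ψ (z, ζ) ![(0, 1), (v, 0)] := by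
    intro ζ
    have e : ((0, -1) : ℂ × ℂ) = -(0, 1) := by simp
    rw [e, two_form_neg_left]
  have key := closed_coclosed_periodic_eq L (hdiff 1) (hdiff I)
    (fun ζ => h.fibre_closed hd hc hz ζ 1 I v)
    (fun ζ => by
      -- The base vector -iv is chosen so that `I` carries it to v, while 1 and i become i and -1.
      -- Fibre closedness of the pull-back then reads as coclosedness of the original contraction.
      have h1 := hI.fibre_closed hdI hc' hz ζ 1 I (-I * v)
      have hII : I * (I * v) = -v := by rw [← mul_assoc, I_mul_I, neg_one_mul]
      simp only [two_form_comp_mulIProd, Prod.smul_mk, smul_eq_mul, mul_zero, mul_one, neg_mul,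
        mul_neg, hII, neg_neg, I_mul_I, hneg] at h1
      rw [fderiv_fun_neg] at h1
      simp only [neg_apply] at h1
      linear_combination h1)
    (hper 1) (hper I) ζ
  have e : ((0, u) : ℂ × ℂ) = u.re • (0, 1) + u.im • (0, I) := by
    simp [re_add_im]
  have e1 : ((v, 0) : ℂ × ℂ) = (1 : ℝ) • (v, 0) := by simp
  rw [e, two_form_add_left, two_form_add_left]
  nth_rw 1 2 3 4 [e1]
  rw [two_form_smul, two_form_smul, two_form_smul, two_form_smul, key.1, key.2]

/-- The vertical part D_v γ drops out against ∂_s γ, and fibrewise constancy moves the evaluation to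
the zero section. What is left is linear in ∂_s γ, so the integral sees only the total displacement
of γ, which is the period. -/
theorem cycleIntegral_eq {c : ℂ → ℂ} {γ : ℂ → ℝ → ℂ} (hγ : P.IsCycle c γ)
    (hv : P.VanishesOnVertical Ψ) (hf : P.FibrewiseConstant Ψ) {z : ℂ} (hz : z ∈ P.U) :
    cycleIntegral Ψ γ z = contractZeroSection Ψ z (c z) := by
  have hopen : IsOpen (P.U ×ˢ (univ : Set ℝ)) := P.isOpen_U.prod isOpen_univ
  have hat : ∀ s : ℝ, ContDiffAt ℝ ∞ (fun q : ℂ × ℝ => γ q.1 q.2) (z, s) := fun s =>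
    hγ.smooth.contDiffAt (hopen.mem_nhds ⟨hz, mem_univ s⟩)
  have hs : ContDiff ℝ ∞ (γ z) := by
    rw [contDiff_iff_contDiffAt]
    intro s
    exact (hat s).comp s (contDiffAt_const.prodMk contDiffAt_id)
  have hint : ∀ s : ℝ,
      ((Ψ (z, γ z s)).curryLeft ((0 : ℂ), deriv (γ z) s)).compContinuousLinearMap
        (fderiv ℝ (fun z' : ℂ => (z', γ z' s)) z) = contractZeroSection Ψ z (deriv (γ z) s) := by
    intro s
    have hb : DifferentiableAt ℝ (fun z' => γ z' s) z :=
      DifferentiableAt.comp (f := fun z' => (z', s)) z ((hat s).differentiableAt (by simp))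
        (differentiableAt_id.prodMk (differentiableAt_const s))
    refine one_form_ext fun v => ?_
    rw [contractZeroSection_apply, ← hf z hz (γ z s),
      ← hv.apply_vert_left (p := (z, γ z s)) ⟨hz, mem_univ _⟩ _ _
        (fderiv ℝ (fun z' => γ z' s) z v)]
    have hfd : fderiv ℝ (fun z' : ℂ => (z', γ z' s)) z =
        (ContinuousLinearMap.id ℝ ℂ).prod (fderiv ℝ (fun z' => γ z' s) z) :=
      ((hasFDerivAt_id z).prodMk hb.hasFDerivAt).fderiv
    rw [hfd]
    change Ψ (z, γ z s) _ = _
    congr 1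
    funext i; fin_cases i <;> rfl
  have hcont : Continuous (deriv (γ z)) := hs.continuous_deriv (by simp)
  rw [cycleIntegral]
  simp only [hint]
  rw [ContinuousLinearMap.intervalIntegral_comp_comm _ (hcont.intervalIntegrable 0 1),
    intervalIntegral.integral_deriv_eq_sub
      (fun s _ => (hs.differentiable (by simp)).differentiableAt)
      (hcont.intervalIntegrable 0 1), hγ.period z hz]
  congr 1
  ring

theorem contDiffOn_contractZeroSection (hΨ : ContDiffOn ℝ ∞ Ψ P.cover) {c : ℂ → ℂ}
    (hc : DifferentiableOn ℂ c P.U) :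
    ContDiffOn ℝ ∞ (fun z => contractZeroSection Ψ z (c z)) P.U := by
  have h0 : ContDiffOn ℝ ∞ (fun z : ℂ => Ψ (z, 0)) P.U :=
    hΨ.comp (contDiff_id.prodMk contDiff_const).contDiffOn fun z hz => ⟨hz, mem_univ _⟩
  have h1 : ContDiffOn ℝ ∞ (fun z : ℂ => (Ψ (z, 0)).curryLeft) P.U :=
    (contDiff_curryLeft (V := ℂ × ℂ) (n := 1)).comp_contDiffOn h0
  have hc' : ContDiffOn ℝ ∞ c P.U := (hc.contDiffOn P.isOpen_U).restrict_scalars ℝ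
  exact (ContinuousAlternatingMap.compContinuousLinearMapCLM
    (ContinuousLinearMap.inl ℝ ℂ ℂ)).contDiff.comp_contDiffOn
      (h1.clm_apply (contDiffOn_const.prodMk hc'))

end FramedPatch
-- Closedness of contractions with a period; flatness of the periods and their image under 𝓜.
theorem fderiv_two_form_apply {E V : Type*} [NormedAddCommGroup E] [NormedSpace ℝ E]
    [NormedAddCommGroup V] [NormedSpace ℝ V] {f : E → V [⋀^Fin 2]→L[ℝ] ℂ} {x y : E → V} {p : E}
    {f' : E →L[ℝ] V [⋀^Fin 2]→L[ℝ] ℂ} {x' y' : E →L[ℝ] V}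
    (hf : HasFDerivAt f f' p) (hx : HasFDerivAt x x' p) (hy : HasFDerivAt y y' p) (w : E) :
    fderiv ℝ (fun q => f q ![x q, y q]) p w =
      f' w ![x p, y p] + f p ![x' w, y p] + f p ![x p, y' w] := by
  have hg : ∀ i, HasFDerivAt ((![x, y] : Fin 2 → E → V) i)
      ((![x', y'] : Fin 2 → E →L[ℝ] V) i) p := by
    intro i
    fin_cases i
    · exact hx
    · exact hy
  have h := fderiv_continuousAlternatingMap_apply_apply hf.differentiableAt
    (fun i => (hg i).differentiableAt) w
  have e : ∀ q, (fun i => (![x, y] : Fin 2 → E → V) i q) = ![x q, y q] := by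
    intro q; funext i; fin_cases i <;> rfl
  simp only [e, (hg _).fderiv, hf.fderiv, Fin.sum_univ_two, Matrix.cons_val_zero,
    Matrix.cons_val_one, update_pair_zero, update_pair_one] at h
  rw [h, add_assoc]

/-- The equation dΨ = 0 on (0, c), (x, 0), (y, 0) expresses the desired derivative up to ∂_c Ψ(x, y)
and the terms containing c'. Hypothesis `hh` says that Ψ vanishes on lifts tangent to the sections
s·c; its s-derivative at s = 0 is the relation that cancels exactly these terms. -/
theorem extDeriv_contractZeroSection {Ψ : ℂ × ℂ → (ℂ × ℂ) [⋀^Fin 2]→L[ℝ] ℂ} {z : ℂ}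
    (hd : DifferentiableAt ℝ Ψ (z, 0)) (hc : extDeriv Ψ (z, 0) = 0) {c : ℂ → ℂ} {c' : ℂ}
    (hcd : HasDerivAt c c' z)
    (hh : ∀ (s : ℝ) (v v' : ℂ), Ψ (z, s * c z) ![(v, s * c' * v), (v', s * c' * v')] = 0)
    (hdiff : DifferentiableAt ℝ (fun z => contractZeroSection Ψ z (c z)) z) :
    extDeriv (fun z => contractZeroSection Ψ z (c z)) z = 0 := by
  ext v
  obtain ⟨x, y, rfl⟩ : ∃ x y, v = ![x, y] := ⟨v 0, v 1, by funext i; fin_cases i <;> rfl⟩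
  rw [extDeriv_one_form_apply hdiff]
  simp only [contractZeroSection_apply]
  have hΨ0 : HasFDerivAt (fun z : ℂ => Ψ (z, 0)) _ z :=
    HasFDerivAt.comp (f := fun z : ℂ => (z, (0 : ℂ))) z hd.hasFDerivAt (hasFDerivAt_prodMk_left z 0)
  have hcr := hcd.hasFDerivAt.restrictScalars ℝ
  have hb : ∀ w v : ℂ, fderiv ℝ (fun z => Ψ (z, 0) ![(0, c z), (v, 0)]) z w =
      fderiv ℝ Ψ (z, 0) (w, 0) ![(0, c z), (v, 0)] + Ψ (z, 0) ![(0, w * c'), (v, 0)] := by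
    intro w v
    rw [fderiv_two_form_apply hΨ0 ((hasFDerivAt_const (0 : ℂ) z).prodMk hcr)
      (hasFDerivAt_const _ _) w]
    have h0 : Ψ (z, 0) ![(0, c z), 0] = 0 :=
      (Ψ (z, 0)).map_coord_zero 1 rfl
    simp [h0]
  have hline : HasFDerivAt (fun s : ℝ => ((z, s * c z) : ℂ × ℂ)) _ 0 :=
    (hasFDerivAt_const z (0 : ℝ)).prodMk (ofRealCLM.hasFDerivAt.mul_const (c z))
  have hlin : ∀ v : ℂ, HasFDerivAt (fun s : ℝ => ((v, s * c' * v) : ℂ × ℂ)) _ 0 := fun v =>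
    (hasFDerivAt_const v (0 : ℝ)).prodMk ((ofRealCLM.hasFDerivAt.mul_const c').mul_const v)
  have hΨl : HasFDerivAt (fun s : ℝ => Ψ (z, s * c z)) _ 0 :=
    HasFDerivAt.comp (f := fun s : ℝ => (z, s * c z)) (0 : ℝ) (g := Ψ)
      (g' := fderiv ℝ Ψ (z, 0)) (by simpa using hd.hasFDerivAt) hline
  have h1 := fderiv_two_form_apply hΨl (hlin x) (hlin y) 1
  have h2 := extDeriv_two_form_apply hd (0, c z) (x, 0) (y, 0)
  -- The function of s differentiated in `h1` is identically zero, so `h1` becomes a linear relation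
  -- at the zero section.
  simp only [hh] at h1
  rw [hc] at h2
  rw [hb, hb]
  have hs := two_form_swap (Ψ (z, 0)) (0, y * c') (x, 0)
  simp [mul_comm c'] at h1 h2 ⊢
  linear_combination h2 - h1 - hs

namespace FramedPatch

variable {X : WeierstrassK3} (P : FramedPatch X)

theorem a_ne_zero {z : ℂ} (hz : z ∈ P.U) : P.a z ≠ 0 := by
  intro h0
  simpa [h0] using P.im_pos z hz

theorem pairing_ne_zero {z : ℂ} (hz : z ∈ P.U) :
    P.a z * conj (P.b z) - P.b z * conj (P.a z) ≠ 0 := by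
  intro h
  have hW := P.W_pos hz
  have h2 := congrArg Complex.im h
  rw [W_eq] at hW
  simp at h2 hW
  linarith

/-- Expanding the numerator at ζ = s·a, the b' terms cancel and a'·(λ, λ̄)·s remains. Reality of s
is essential, because ζ̄ also occurs. Thus the sections s·a are horizontal. -/
theorem conn_smul_a {z : ℂ} (hz : z ∈ P.U) (s : ℝ) :
    P.conn (z, s * P.a z) = s * deriv P.a z := by
  refine (div_eq_iff (P.pairing_ne_zero hz)).2 ?_
  simp [periodPairing, dlam, lam, lamBar]
  ring

theorem conn_smul_b {z : ℂ} (hz : z ∈ P.U) (s : ℝ) :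
    P.conn (z, s * P.b z) = s * deriv P.b z := by
  refine (div_eq_iff (P.pairing_ne_zero hz)).2 ?_
  simp [periodPairing, dlam, lam, lamBar]
  ring

/-- On the periods of `λ`, the matrix `𝓜` is the Hodge star of the fibre. -/
theorem axioMatrix_periods {z : ℂ} (hz : z ∈ P.U) :
    P.axioMatrix z 0 0 * P.a z + P.axioMatrix z 0 1 * P.b z = -(I * P.b z) ∧
    P.axioMatrix z 1 0 * P.a z + P.axioMatrix z 1 1 * P.b z = I * P.a z := by
  have ha := P.a_ne_zero hz
  have hb : P.b z = P.tau z * P.a z := by rw [tau, div_mul_cancel₀ _ ha]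
  have him : ((P.tau z).im : ℂ) ≠ 0 := ofReal_ne_zero.2 (P.im_pos z hz).ne'
  have hτ := re_add_im (P.tau z)
  have hn : ((‖P.tau z‖ : ℂ)) ^ 2 = (P.tau z).re ^ 2 + (P.tau z).im ^ 2 := by
    rw [← ofReal_pow, Complex.sq_norm, normSq_apply]
    push_cast
    ring
  rw [hb]
  constructor
  · simp [axioMatrix, hn]
    field_simp
    linear_combination ((P.tau z).re - I * (P.tau z).im) * hτ + ((P.tau z).im : ℂ) ^ 2 * I_sq
  · simp [axioMatrix]
    field_simp
    linear_combination -hτ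

end FramedPatch

namespace FramedPatch

variable {X : WeierstrassK3} {P : FramedPatch X} {Ψ : ℂ × ℂ → (ℂ × ℂ) [⋀^Fin 2]→L[ℝ] ℂ}

/-- Cycle integrals are real linear in the period, so 𝓜 may be applied to the periods instead of to
the integrals. -/
theorem lower_apply {α β : ℂ → ℝ → ℂ} (hα : P.IsCycle P.a α) (hβ : P.IsCycle P.b β)
    (hv : P.VanishesOnVertical Ψ) (hf : P.FibrewiseConstant Ψ) {z : ℂ} (hz : z ∈ P.U)
    (v : ℂ) :
    P.lower (doublet α β Ψ) 0 z (fun _ => v) = -Ψ (z, 0) ![(0, I * P.b z), (v, 0)] ∧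
    P.lower (doublet α β Ψ) 1 z (fun _ => v) = Ψ (z, 0) ![(0, I * P.a z), (v, 0)] := by
  have h : ∀ i, P.lower (doublet α β Ψ) i z = contractZeroSection Ψ z
      (P.axioMatrix z i 0 * P.a z + P.axioMatrix z i 1 * P.b z) := by
    intro i
    rw [lower, Fin.sum_univ_two, ← real_smul, ← real_smul, map_add, map_smul, map_smul,
      ← cycleIntegral_eq hα hv hf hz, ← cycleIntegral_eq hβ hv hf hz]
    rfl
  obtain ⟨h0, h1⟩ := P.axioMatrix_periods hz
  constructor
  · rw [h, h0, map_neg, ContinuousAlternatingMap.neg_apply, contractZeroSection_apply]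
  · rw [h, h1, contractZeroSection_apply]

theorem contractZeroSection_comp_mulI (z u v : ℂ) :
    contractZeroSection (fun p => (Ψ p).compContinuousLinearMap mulIProd) z u (fun _ => v) =
      Ψ (z, 0) ![(0, I * u), (I * v, 0)] := by
  rw [contractZeroSection_apply, two_form_comp_mulIProd]
  simp

theorem extDeriv_contract_period (hs : ContDiffOn ℝ ∞ Ψ P.cover)
    (hc : ∀ p ∈ P.cover, extDeriv Ψ p = 0)
    (hh : ∀ p ∈ P.cover, ∀ v v' : ℂ, Ψ p ![P.hor p v, P.hor p v'] = 0) {c : ℂ → ℂ}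
    (hcd : DifferentiableOn ℂ c P.U)
    (hconn : ∀ z ∈ P.U, ∀ s : ℝ, P.conn (z, s * c z) = s * deriv c z) {z : ℂ} (hz : z ∈ P.U) :
    extDeriv (fun z => contractZeroSection Ψ z (c z)) z = 0 := by
  have hp : ∀ ζ : ℂ, ((z, ζ) : ℂ × ℂ) ∈ P.cover := fun _ => ⟨hz, mem_univ _⟩
  refine extDeriv_contractZeroSection
    ((hs.contDiffAt (P.isOpen_cover.mem_nhds (hp 0))).differentiableAt (by simp)) (hc _ (hp 0))
    (hcd.differentiableAt (P.isOpen_U.mem_nhds hz)).hasDerivAt (fun s v v' => ?_)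
    (((contDiffOn_contractZeroSection hs hcd).contDiffAt
      (P.isOpen_U.mem_nhds hz)).differentiableAt (by simp))
  have h := hh _ (hp (s * c z)) v v'
  rwa [hor, hor, hconn z hz] at h

theorem hor_I_smul (p : ℂ × ℂ) (v : ℂ) : I • P.hor p v = P.hor p (I * v) := by
  ext
  · simp [hor]
  · simp [hor]
    ring

end FramedPatch
end SemiflatK3

/-! ### Assembly of the proposition. -/

open SemiflatK3 SemiflatK3.FramedPatch in
theorem mainTheorem5 (X : SemiflatK3.WeierstrassK3) (P : SemiflatK3.FramedPatch X)
    (t : ℝ) (ht : 0 < t)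
    -- orientations: `o` on the base, `-o` on the total space
    (o : ℤˣ)
    (α β : ℂ → ℝ → ℂ) (hα : P.IsCycle P.a α) (hβ : P.IsCycle P.b β)
    (Ξ : ℂ × ℂ → (ℂ × ℂ) [⋀^Fin 2]→L[ℝ] ℂ)
    (hΞ : P.IsSemiflatHarmonic t (-o) Ξ)
    (hzz : ∀ p ∈ P.cover, P.compZZbar Ξ p = 0)
    (hww : ∀ p ∈ P.cover, SemiflatK3.FramedPatch.compWWbar Ξ p = 0) :
    (∀ z ∈ P.U,
      P.baseStar o (P.lower (SemiflatK3.doublet α β Ξ) 0) z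
        = SemiflatK3.cycleIntegral (P.sfStar t (-o) Ξ) β z ∧
      P.baseStar o (P.lower (SemiflatK3.doublet α β Ξ) 1) z
        = -SemiflatK3.cycleIntegral (P.sfStar t (-o) Ξ) α z) ∧
    (∀ i : Fin 2,
      ContDiffOn ℝ ∞ (P.baseStar o (P.lower (SemiflatK3.doublet α β Ξ) i)) P.U ∧
      ∀ z ∈ P.U, extDeriv (P.baseStar o (P.lower (SemiflatK3.doublet α β Ξ) i)) z = 0) := by
  have hv := vanishesOnVertical_of_compWWbar hww
  have hcast : (-((((-o : ℤˣ) : ℤ)) : ℝ)) = ((o : ℤ) : ℝ) := by simp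
  have hstar : ∀ p ∈ P.cover, P.sfStar t (-o) Ξ p =
      ((o : ℤ) : ℝ) • (Ξ p).compContinuousLinearMap mulIProd := by
    intro p hp
    rw [P.sfStar_eq_comp_mulI ht (-o) Ξ hp (hzz p hp) (hww p hp), hcast]
  have hdiff : ∀ p ∈ P.cover, DifferentiableAt ℝ Ξ p := fun p hp =>
    (hΞ.smooth.contDiffAt (P.isOpen_cover.mem_nhds hp)).differentiableAt (by simp)
  have hsI : ContDiffOn ℝ ∞ (fun p => (Ξ p).compContinuousLinearMap mulIProd) P.cover :=
    (ContinuousAlternatingMap.compContinuousLinearMapCLM (F := ℂ) (ι := Fin 2)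
      mulIProd).contDiff.comp_contDiffOn hΞ.smooth
  have ho : ((o : ℤ) : ℝ) ≠ 0 := by simp
  -- The star agrees with ±1 times the pull-back on an open set, so coclosedness of Ξ is closedness
  -- of its pull-back under `I`.
  have hcI : ∀ p ∈ P.cover,
      extDeriv (fun p => (Ξ p).compContinuousLinearMap mulIProd) p = 0 := by
    intro p hp
    have h := hΞ.coclosed p hp
    have he : P.sfStar t (-o) Ξ =ᶠ[nhds p]
        ((o : ℤ) : ℝ) • fun p => (Ξ p).compContinuousLinearMap mulIProd :=
      Filter.eventually_of_mem (P.isOpen_cover.mem_nhds hp) hstar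
    rw [he.extDeriv_eq, extDeriv_smul] at h
    exact (smul_eq_zero.1 h).resolve_left ho
  have hf := fibrewiseConstant_of_closed_coclosed hv hdiff hΞ.closed hcI hΞ.invariant
  have hvS : P.VanishesOnVertical (P.sfStar t (-o) Ξ) := by
    intro p hp u u'
    rw [hstar p hp, ContinuousAlternatingMap.smul_apply, two_form_comp_mulIProd]
    have h := hv p hp (I * u) (I * u')
    simpa using h
  have hS : ∀ z ∈ P.U, ∀ ζ u v : ℂ, P.sfStar t (-o) Ξ (z, ζ) ![(0, u), (v, 0)] =
      ((o : ℤ) : ℝ) • Ξ (z, ζ) ![(0, I * u), (I * v, 0)] := by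
    intro z hz ζ u v
    rw [hstar (z, ζ) ⟨hz, mem_univ _⟩, ContinuousAlternatingMap.smul_apply,
      two_form_comp_mulIProd]
    simp
  have hfS : P.FibrewiseConstant (P.sfStar t (-o) Ξ) := by
    intro z hz ζ u v
    rw [hS z hz, hS z hz, hf z hz]
  have hlow := fun z (hz : z ∈ P.U) v => lower_apply hα hβ hv hf hz v
  have main : ∀ z ∈ P.U,
      P.baseStar o (P.lower (doublet α β Ξ) 0) z = cycleIntegral (P.sfStar t (-o) Ξ) β z ∧
      P.baseStar o (P.lower (doublet α β Ξ) 1) z = -cycleIntegral (P.sfStar t (-o) Ξ) α z := by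
    intro z hz
    constructor <;> refine one_form_ext fun v => ?_
    · rw [P.baseStar_eq_comp_mulI o _ hz, cycleIntegral_eq hβ hvS hfS hz,
        contractZeroSection_apply, hS z hz]
      change -((o : ℤ) : ℝ) • P.lower (doublet α β Ξ) 0 z (fun _ => I * v) = _
      -- The sign -o of the base star meets the minus sign in 𝓜(a, b) = (-ib, ia), leaving the +o of
      -- the star on the oppositely oriented total space.
      rw [(hlow z hz _).1, neg_smul_neg]
    · rw [P.baseStar_eq_comp_mulI o _ hz, cycleIntegral_eq hα hvS hfS hz,
        ContinuousAlternatingMap.neg_apply, contractZeroSection_apply, hS z hz]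
      change -((o : ℤ) : ℝ) • P.lower (doublet α β Ξ) 1 z (fun _ => I * v) = _
      rw [(hlow z hz _).2, neg_smul]
  have hhI : ∀ p ∈ P.cover, ∀ v v' : ℂ,
      (Ξ p).compContinuousLinearMap mulIProd ![P.hor p v, P.hor p v'] = 0 := by
    intro p hp v v'
    rw [two_form_comp_mulIProd, hor_I_smul, hor_I_smul, hor_pair_eq_zero (hzz p hp)]
  have hform : ∀ (γ : ℂ → ℝ → ℂ) (c : ℂ → ℂ), P.IsCycle c γ → ∀ z ∈ P.U,
      cycleIntegral (P.sfStar t (-o) Ξ) γ z = ((o : ℤ) : ℝ) •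
        contractZeroSection (fun p => (Ξ p).compContinuousLinearMap mulIProd) z (c z) := by
    intro γ c hγ z hz
    refine one_form_ext fun v => ?_
    rw [cycleIntegral_eq hγ hvS hfS hz, contractZeroSection_apply, hS z hz,
      ContinuousAlternatingMap.smul_apply, contractZeroSection_comp_mulI]
  -- Smoothness and closedness are read off from the contraction of the pulled-back form with a
  -- holomorphic period, so neither 𝓜 nor the base star has to be differentiated.
  have conclude : ∀ (η : ℂ → ℂ [⋀^Fin 1]→L[ℝ] ℂ) (r : ℝ) (c : ℂ → ℂ),
      DifferentiableOn ℂ c P.U →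
      (∀ z ∈ P.U, ∀ s : ℝ, P.conn (z, s * c z) = s * deriv c z) →
      (∀ z ∈ P.U, η z = r •
        contractZeroSection (fun p => (Ξ p).compContinuousLinearMap mulIProd) z (c z)) →
      ContDiffOn ℝ ∞ η P.U ∧ ∀ z ∈ P.U, extDeriv η z = 0 := by
    intro η r c hc hconn hη
    refine ⟨((contDiffOn_contractZeroSection hsI hc).const_smul r).congr hη, fun z hz => ?_⟩
    have he : η =ᶠ[nhds z] r • fun z =>
        contractZeroSection (fun p => (Ξ p).compContinuousLinearMap mulIProd) z (c z) :=
      Filter.eventually_of_mem (P.isOpen_U.mem_nhds hz) hη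
    rw [he.extDeriv_eq, extDeriv_smul, extDeriv_contract_period hsI hcI hhI hc hconn hz,
      smul_zero]
  refine ⟨main, fun i => ?_⟩
  fin_cases i
  · exact conclude _ ((o : ℤ) : ℝ) P.b P.holomorphic_b (fun z hz => P.conn_smul_b hz)
      fun z hz => by rw [← hform β P.b hβ z hz]; exact (main z hz).1
  · exact conclude _ (-((o : ℤ) : ℝ)) P.a P.holomorphic_a (fun z hz => P.conn_smul_a hz)
      fun z hz => (main z hz).2.trans (by rw [hform α P.a hα z hz]; exact (neg_smul _ _).symm)
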